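/- Let $n\ge 1$ and $[n]=\{1,\dots,n\}$. For a tuple $X=(X_1,\dots,X_n)$ of compact convex sets in $\mathbb{R}^2$ let $\operatorname{pat}_X(p)=\{i\in[n] : p\in X_i\}$ for $p\in\mathbb{R}^2$, and let $\operatorname{code}(X)=\{\operatorname{pat}_X(p) : p\in\mathbb{R}^2\}$. A set $P\subseteq\mathbb{R}^2$ is a set of representatives for $X$ if $\operatorname{code}(X)=\{\operatorname{pat}_X(p) : p\in P\}$. A tuple $Y=(Y_1,\dots,Y_n)$ of compact convex sets in $\mathbb{R}^2$ is called inclusion-minimal with respect to $X$ and $P$ if (i) $Y_i\subseteq X_i$ for all $i$, (ii) $Y_i\cap P=X_i\cap P$ for all $i$, (iii) $\operatorname{code}(Y)=\operatorname{code}(X)$, and (iv) no other tuple $Z$ of compact convex sets satisfying (i)--(iii) has $Z_i\subseteq Y_i$ for all $i$. A polygon is the convex hull of a finite set of points in $\mathbb{R}^2$ (segments, single points and the empty set are allowed), and its vertices are its extreme points. (a) Let $X$ be a tuple of $n$ compact convex sets in $\mathbb{R}^2$, let $P$ be a finite set of representatives for $X$, and let $Y$ be inclusion-minimal with respect to $X$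 and $P$. Then each $Y_i$ is a polygon with at most $3^n\,(n-1)!\,|P|$ vertices. (b) In particular, if moreover $|P|\le 2^n$, then each $Y_i$ is a polygon with at most $6^n\,(n-1)!$ vertices. (c) For every tuple $X$ of $n$ compact convex sets in $\mathbb{R}^2$ there are a set $P$ of representatives for $X$ with $|P|\le 2^n$ and a tuple $Y$ that is inclusion-minimal with respect to $X$ and $P$. Hence every code $\mathcal{C}\subseteq 2^{[n]}$ of the form $\mathcal{C}=\operatorname{code}(X)$, with $X$ such a tuple, satisfies $\mathcal{C}=\operatorname{code}(Y)$ for a tuple $Y$ of polygons with at most $6^n\,(n-1)!$ vertices each. -/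

import Mathlib

open scoped Nat

/-- The intersection pattern of the tuple `X` at `p`: the set of indices `i` with `p ∈ X i`. -/
def intersectionPattern {n d : ℕ} (X : Fin n → Set (EuclideanSpace ℝ (Fin d)))
    (p : EuclideanSpace ℝ (Fin d)) : Set (Fin n) :=
  {i | p ∈ X i}

/-- The code of the tuple `X`: the set of all its intersection patterns. -/
def code {n d : ℕ} (X : Fin n → Set (EuclideanSpace ℝ (Fin d))) : Set (Set (Fin n)) :=
  {c | ∃ p : EuclideanSpace ℝ (Fin d), intersectionPattern X p = c}

/-- `X` is a tuple of compact convex sets. -/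
def IsCompactConvexTuple {n d : ℕ} (X : Fin n → Set (EuclideanSpace ℝ (Fin d))) : Prop :=
  ∀ i, IsCompact (X i) ∧ Convex ℝ (X i)

/-- `X` is a closed convex `d`-realization of `C`. The sets of a realization are bounded by
convention, so that the closed realizations are those by compact convex sets. -/
def IsClosedRealization {n d : ℕ} (C : Set (Set (Fin n)))
    (X : Fin n → Set (EuclideanSpace ℝ (Fin d))) : Prop :=
  IsCompactConvexTuple X ∧ code X = C

/-- `P` is a set of representatives for `X`: the patterns at the points of `P` are exactly the
codewords of `X`. -/
def IsSetOfRepresentatives {n d : ℕ} (X : Fin n → Set (EuclideanSpace ℝ (Fin d)))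
    (P : Set (EuclideanSpace ℝ (Fin d))) : Prop :=
  code X = {c | ∃ p ∈ P, intersectionPattern X p = c}

/-- `Z` is a tuple of compact convex sets contained in those of `X`, with the same points of `P`
in each set, and with the same code as `X`. -/
structure IsShrinking {n d : ℕ} (X : Fin n → Set (EuclideanSpace ℝ (Fin d)))
    (P : Set (EuclideanSpace ℝ (Fin d))) (Z : Fin n → Set (EuclideanSpace ℝ (Fin d))) :
    Prop where
  compactConvex : IsCompactConvexTuple Z
  subset : ∀ i, Z i ⊆ X i
  inter_eq : ∀ i, Z i ∩ P = X i ∩ P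
  code_eq : code Z = code X

/-- `Y` is an inclusion-minimal realization of the code of `X` with respect to `P`: it is a
shrinking of `X`, and no shrinking of `X` other than `Y` is contained in `Y` coordinatewise. -/
def IsInclusionMinimal {n d : ℕ} (X : Fin n → Set (EuclideanSpace ℝ (Fin d)))
    (P : Set (EuclideanSpace ℝ (Fin d))) (Y : Fin n → Set (EuclideanSpace ℝ (Fin d))) : Prop :=
  IsShrinking X P Y ∧ ∀ Z, IsShrinking X P Z → (∀ i, Z i ⊆ Y i) → Z = Y

/-- A (convex, closed, possibly degenerate) polygon: the convex hull of finitely many points of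
the plane. Line segments, points and the empty set are allowed. -/
def IsPolygon (S : Set (EuclideanSpace ℝ (Fin 2))) : Prop :=
  ∃ F : Finset (EuclideanSpace ℝ (Fin 2)),
    S = convexHull ℝ (F : Set (EuclideanSpace ℝ (Fin 2)))

/-- The number of vertices (extreme points) of a convex set, possibly infinite. -/
noncomputable def numVertices (S : Set (EuclideanSpace ℝ (Fin 2))) : ℕ∞ :=
  (Set.extremePoints ℝ S).encard

/-! ### Convex sets: caps, supporting functionals, visible extreme points -/

section ConvexGeometry

variable {E : Type*} [NormedAddCommGroup E] [NormedSpace ℝ E]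

/-! For a set S of indices let H be the hull of the `Y k`, k ∈ S, and e(S) its number of extreme
points. If v ∉ P is extreme in H, some `Y k` has v on its boundary and leaves H arbitrarily close to
v, so k ∉ S. Otherwise a small cap at v could be cut off every set with v on its boundary without
creating a new pattern, against minimality (`IsInclusionMinimal.exists_mem_closure_diff`).

Charge v to an extreme point u of conv(H ∪ `Y k`) that is joined, by segments missing H, to points
of `Y k` arbitrarily close to v. In the plane, for fixed k, each u is charged at most twice
(`encard_extremePoints_frontier_le`). Hence e(S) ≤ |P| + 2 ∑_{k ∉ S} e(S ∪ {k}), and induction on m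
= |Sᶜ| gives e(S) ≤ 3^(m+1) m! |P|; singletons S give the bound. Existence of a minimal Y is Zorn's
lemma. -/

theorem IsCompact.convexHull_union_of_convex {s t : Set E} (hs : IsCompact s) (ht : IsCompact t)
    (hsc : Convex ℝ s) (htc : Convex ℝ t) : IsCompact (convexHull ℝ (s ∪ t)) := by
  rcases s.eq_empty_or_nonempty with rfl | hs₀
  · simpa [htc.convexHull_eq] using ht
  rcases t.eq_empty_or_nonempty with rfl | ht₀
  · simpa [hsc.convexHull_eq] using hs
  rw [hsc.convexHull_union htc hs₀ ht₀]
  have h : convexJoin ℝ s t =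
      (fun q : ℝ × E × E => AffineMap.lineMap q.2.1 q.2.2 q.1) '' (Set.Icc 0 1 ×ˢ s ×ˢ t) := by
    ext x
    simp only [mem_convexJoin, segment_eq_image_lineMap, Set.mem_image, Set.mem_prod, Prod.exists]
    constructor
    · rintro ⟨a, ha, b, hb, r, hr, rfl⟩
      exact ⟨r, a, b, ⟨hr, ha, hb⟩, rfl⟩
    · rintro ⟨r, a, b, ⟨hr, ha, hb⟩, rfl⟩
      exact ⟨a, ha, b, hb, r, hr, rfl⟩
  rw [h]
  refine (isCompact_Icc.prod (hs.prod ht)).image ?_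
  simp only [AffineMap.lineMap_apply_module]
  fun_prop

theorem isCompact_convexHull_biUnion {ι : Type*} (s : Finset ι) (C : ι → Set E)
    (h : ∀ i ∈ s, IsCompact (C i) ∧ Convex ℝ (C i)) :
    IsCompact (convexHull ℝ (⋃ i ∈ s, C i)) := by
  classical
  induction s using Finset.induction_on with
  | empty => simp
  | insert a s _ ih =>
    have e : convexHull ℝ (C a ∪ convexHull ℝ (⋃ i ∈ s, C i)) = convexHull ℝ (C a ∪ ⋃ i ∈ s, C i) :=
      (convexHull ℝ).closure_sup_closure_right _ _
    rw [Finset.set_biUnion_insert, ← e]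
    have ha := h a (Finset.mem_insert_self _ _)
    exact ha.1.convexHull_union_of_convex
      (ih fun i hi => h i (Finset.mem_insert_of_mem hi)) ha.2 (convex_convexHull ℝ _)

/-- A compact convex set has arbitrarily small caps at each of its extreme points. -/
theorem exists_cap_of_mem_extremePoints {H : Set E} (hH : IsCompact H) (hHc : Convex ℝ H) {v : E}
    (hv : v ∈ H.extremePoints ℝ) {ε : ℝ} (hε : 0 < ε) :
    ∃ (f : StrongDual ℝ E) (r : ℝ), r < f v ∧ ∀ y ∈ H, r < f y → dist y v < ε := by
  have hK : IsCompact (H \ Metric.ball v ε) := hH.diff Metric.isOpen_ball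
  obtain ⟨s, hsK, hs⟩ := hK.elim_nhds_subcover (fun x => Metric.ball x (ε / 2))
    fun x _ => Metric.ball_mem_nhds x (half_pos hε)
  have hC := isCompact_convexHull_biUnion s (fun x => H ∩ Metric.closedBall x (ε / 2))
    fun x _ => ⟨hH.inter_right Metric.isClosed_closedBall, hHc.inter (convex_closedBall _ _)⟩
  set U := ⋃ x ∈ s, H ∩ Metric.closedBall x (ε / 2) with hU
  have hUH : U ⊆ H := by simp [hU]
  -- Were v in this hull, extremality would put it in one of the pieces; but their centres are at
  -- distance at least ε from v and their radii are ε / 2.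
  have hvU : v ∉ convexHull ℝ U := by
    intro hmem
    have hvext : v ∈ (convexHull ℝ U).extremePoints ℝ :=
      inter_extremePoints_subset_extremePoints_of_subset (convexHull_min hUH hHc) ⟨hmem, hv⟩
    have := extremePoints_convexHull_subset hvext
    simp only [hU, Set.mem_iUnion] at this
    obtain ⟨x, hx, -, hvx⟩ := this
    have h1 := (hsK x hx).2
    rw [Metric.mem_ball, not_lt] at h1
    rw [Metric.mem_closedBall, dist_comm] at hvx
    linarith
  obtain ⟨f, r, hf, hr⟩ :=
    geometric_hahn_banach_closed_point (convex_convexHull ℝ U) hC.isClosed hvU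
  refine ⟨f, r, hr, fun y hy hry => ?_⟩
  by_contra hd
  have hyU : y ∈ U := by
    have := hs ⟨hy, fun h => hd (Metric.mem_ball.1 h)⟩
    simp only [Set.mem_iUnion] at this
    obtain ⟨x, hx, hyx⟩ := this
    simp only [hU, Set.mem_iUnion]
    exact ⟨x, hx, hy, Metric.ball_subset_closedBall hyx⟩
  exact (hf y (subset_convexHull ℝ U hyU)).not_gt hry

/-- A convex set in finite dimension has a supporting functional at each of the points outside its
interior. -/
theorem Convex.exists_supporting_functional [FiniteDimensional ℝ E] {K : Set E}
    (hK : Convex ℝ K) {v : E} (hvK : v ∈ K) (hv : v ∉ interior K) :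
    ∃ f : StrongDual ℝ E, f ≠ 0 ∧ ∀ y ∈ K, f y ≤ f v := by
  by_cases hint : (interior K).Nonempty
  · exact geometric_hahn_banach_of_nonempty_interior_point hK hv hint
  have hd : vectorSpan ℝ K ≠ ⊤ := fun h => hint <| by
    rw [hK.interior_nonempty_iff_affineSpan_eq_top,
      AffineSubspace.affineSpan_eq_top_iff_vectorSpan_eq_top_of_nonempty ℝ E E ⟨v, hvK⟩]
    exact h
  obtain ⟨f, hf, hle⟩ := Submodule.exists_le_ker_of_lt_top _ (lt_top_iff_ne_top.2 hd)
  refine ⟨LinearMap.toContinuousLinearMap f, by simpa using hf, fun y hy => ?_⟩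
  have : f (y - v) = 0 := hle (vsub_mem_vectorSpan ℝ hy hvK)
  rw [map_sub, sub_eq_zero] at this
  simp [this]

/-- If `x ∉ H` lies in `K`, then `x` is joined by a segment avoiding `H` to an extreme point of
`convexHull ℝ (H ∪ K)` that lies in `K`. -/
theorem exists_extremePoint_segment_disjoint {H K : Set E} (hH : IsCompact H) (hHc : Convex ℝ H)
    (hK : IsCompact K) (hKc : Convex ℝ K) {x : E} (hxK : x ∈ K) (hxH : x ∉ H) :
    ∃ u ∈ (convexHull ℝ (H ∪ K)).extremePoints ℝ, u ∈ K ∧ Disjoint (segment ℝ x u) H := by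
  obtain ⟨f, r, hf, hr⟩ := geometric_hahn_banach_closed_point hHc hH.isClosed hxH
  have hcomp := hH.convexHull_union_of_convex hK hHc hKc
  have hx' : x ∈ convexHull ℝ (H ∪ K) := subset_convexHull ℝ _ (Or.inr hxK)
  obtain ⟨z, hz, hmax⟩ := hcomp.exists_isMaxOn ⟨x, hx'⟩ f.continuous.continuousOn
  have hexp : IsExposed ℝ (convexHull ℝ (H ∪ K)) (f.toExposed (convexHull ℝ (H ∪ K))) :=
    ContinuousLinearMap.toExposed.isExposed
  -- `f` separates `x` from `H`. On the face where `f` is maximal it is at least `f x`, so the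
  -- segment from `x` to `u` stays above `H`.
  obtain ⟨u, hu⟩ := (hexp.isCompact hcomp).extremePoints_nonempty ⟨z, hz, hmax⟩
  have hue := hexp.isExtreme.extremePoints_subset_extremePoints hu
  have hxu : f x ≤ f u := hu.1.2 x hx'
  have huH : u ∉ H := fun h => by linarith [hf u h]
  refine ⟨u, hue, (extremePoints_convexHull_subset hue).resolve_left huH, ?_⟩
  rw [Set.disjoint_left]
  rintro y ⟨a, b, ha, hb, hab, rfl⟩ hy
  have := hf _ hy
  simp only [map_add, map_smul, smul_eq_mul] at this
  nlinarith [mul_le_mul_of_nonneg_left hxu hb, congrArg (· * f x) hab]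

end ConvexGeometry

/-! ### Counting boundary extreme points in the plane -/

section Plane

variable {E : Type*} [NormedAddCommGroup E] [NormedSpace ℝ E]

/-- Since `s < 0`, the point on the line lies beyond `v₂`, so `f` cannot be smaller at `v₁` than at
`v₂`; then `γ < 0` forces the same for `v₃`. For affinely spanning points this rules out a nonzero
supporting functional at `v₂`. -/
theorem eq_of_supporting_of_mem_line {f : StrongDual ℝ E} {v₁ v₂ v₃ : E} {α β γ s : ℝ}
    (h : α + β + γ = 1) (hγ : γ < 0) (hs : s < 0)
    (h₁ : f v₁ ≤ f v₂) (h₃ : f v₃ ≤ f v₂) (hy : f (s • v₁ + (1 - s) • v₂) ≤ f v₂)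
    (hu : f (α • v₁ + β • v₂ + γ • v₃) ≤ f v₂) : f v₁ = f v₂ ∧ f v₁ = f v₃ := by
  simp only [map_add, map_smul, smul_eq_mul] at hu hy
  obtain rfl : β = 1 - α - γ := by linarith
  have e₁ := mul_nonneg_of_nonpos_of_nonpos hs.le (sub_nonpos.2 h₁)
  have z₁ : s * (f v₁ - f v₂) = 0 := by nlinarith
  have q₁ : f v₁ = f v₂ := by linarith [(mul_eq_zero.1 z₁).resolve_left hs.ne]
  rw [q₁] at hu
  have e₃ := mul_nonneg_of_nonpos_of_nonpos hγ.le (sub_nonpos.2 h₃)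
  have z₃ : γ * (f v₃ - f v₂) = 0 := by nlinarith
  exact ⟨q₁, by linarith [(mul_eq_zero.1 z₃).resolve_left hγ.ne]⟩

/-- If `u` and `x` are on different sides of the line through `v₁` and `v₂`, then the segment
between them meets the convex set `H` spanned by boundary points of `K`. -/
theorem exists_mem_segment_of_supporting {H K : Set E} (hH : Convex ℝ H) (hK : Convex ℝ K)
    {v₁ v₂ v₃ u x : E} (h₁ : v₁ ∈ H ∩ K) (h₂ : v₂ ∈ H ∩ K) (h₃ : v₃ ∈ H ∩ K)
    (s₁ : ∃ f : StrongDual ℝ E, f ≠ 0 ∧ ∀ y ∈ K, f y ≤ f v₁)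
    (s₂ : ∃ f : StrongDual ℝ E, f ≠ 0 ∧ ∀ y ∈ K, f y ≤ f v₂)
    (hspan : ∀ f : StrongDual ℝ E, f v₁ = f v₂ → f v₁ = f v₃ → f = 0)
    (hu : u ∈ K) (hx : x ∈ K) {α β γ a b c : ℝ} (hu' : u = α • v₁ + β • v₂ + γ • v₃)
    (hx' : x = a • v₁ + b • v₂ + c • v₃) (hsu : α + β + γ = 1) (hsx : a + b + c = 1)
    (hγ : γ < 0) (hc : 0 < c) : ∃ y ∈ segment ℝ x u, y ∈ H := by
  have hd : 0 < c - γ := by linarith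
  -- These weights cancel the `v₃`-coordinate: they give the point where the segment crosses the
  -- line through `v₁` and `v₂`.
  set t := -γ / (c - γ) with ht
  set t' := c / (c - γ) with ht'
  have htt : t + t' = 1 := by rw [ht, ht']; field_simp; ring
  have hct : t * c + t' * γ = 0 := by rw [ht, ht']; field_simp; ring
  have hy : t • x + t' • u ∈ segment ℝ x u :=
    ⟨t, t', div_nonneg (by linarith) hd.le, div_nonneg hc.le hd.le, htt, rfl⟩
  have hyK := hK.segment_subset hx hu hy
  set s := t * a + t' * α with hs
  have hs2 : t * b + t' * β = 1 - s := by
    rw [hs]; linear_combination t * hsx + t' * hsu + htt - hct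
  have hyeq : t • x + t' • u = s • v₁ + (1 - s) • v₂ := by
    have : t • x + t' • u = (t * a + t' * α) • v₁ + (t * b + t' * β) • v₂
        + (t * c + t' * γ) • v₃ := by
      rw [hu', hx']; module
    rw [this, hct, hs2, zero_smul, add_zero]
  rw [hyeq] at hyK hy
  -- A crossing point beyond `v₂` or `v₁` contradicts the supporting functional there, so it lies
  -- between them, hence in `H`.
  rcases lt_or_ge s 0 with h0 | h0
  · obtain ⟨f, hf, hfK⟩ := s₂
    obtain ⟨q₁, q₂⟩ := eq_of_supporting_of_mem_line hsu hγ h0 (hfK _ h₁.2) (hfK _ h₃.2)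
      (hfK _ hyK) (hfK _ (hu' ▸ hu))
    exact (hf (hspan f q₁ q₂)).elim
  rcases lt_or_ge (1 - s) 0 with h0' | h0'
  · obtain ⟨f, hf, hfK⟩ := s₁
    have hyK' : (1 - s) • v₂ + (1 - (1 - s)) • v₁ ∈ K := by
      convert hyK using 1; module
    have hu'' : β • v₂ + α • v₁ + γ • v₃ ∈ K := by
      convert hu using 1; rw [hu']; module
    obtain ⟨q₁, q₂⟩ := eq_of_supporting_of_mem_line (by linarith) hγ h0' (hfK _ h₂.2)
      (hfK _ h₃.2) (hfK _ hyK') (hfK _ hu'')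
    exact (hf (hspan f q₁.symm (q₁.symm.trans q₂))).elim
  · exact ⟨_, hy, hH h₁.1 h₂.1 h0 h0' (by ring)⟩

/-- Let `H` and `K` be convex sets in a plane, and let the basis points lie in `H` and on the
boundary of `K`. A point of `K` outside `H` is not visible from the points of `K` near one of
the basis points. -/
theorem exists_eventually_not_disjoint_segment {H K : Set E} (hH : Convex ℝ H) (hK : Convex ℝ K)
    (b : AffineBasis (Fin 3) ℝ E) [FiniteDimensional ℝ E] (hb : ∀ i, b i ∈ H ∩ K)
    (hs : ∀ i, ∃ f : StrongDual ℝ E, f ≠ 0 ∧ ∀ y ∈ K, f y ≤ f (b i)) {u : E} (huK : u ∈ K)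
    (huH : u ∉ H) :
    ∃ i, ∀ᶠ x in nhds (b i), x ∈ K → ¬ Disjoint (segment ℝ x u) H := by
  have hcomb : ∀ x, x = b.coord 0 x • b 0 + b.coord 1 x • b 1 + b.coord 2 x • b 2 := fun x => by
    rw [← Fin.sum_univ_three (fun i => b.coord i x • b i), b.linear_combination_coord_eq_self]
  have hsum : ∀ x, b.coord 0 x + b.coord 1 x + b.coord 2 x = 1 := fun x => by
    rw [← Fin.sum_univ_three (fun i => b.coord i x), b.sum_coord_apply_eq_one]
  have hspan : ∀ f : StrongDual ℝ E, f (b 0) = f (b 1) → f (b 0) = f (b 2) → f = 0 := by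
    intro f h1 h2
    have hc : ∀ x, f x = f (b 0) := fun x => by
      conv_lhs => rw [hcomb x]
      simp only [map_add, map_smul, smul_eq_mul, ← h1, ← h2]
      linear_combination f (b 0) * hsum x
    ext x
    rw [hc x, ← hc 0, map_zero]; rfl
  have hev : ∀ i, ∀ᶠ x in nhds (b i), 0 < b.coord i x := fun i => by
    have hc : Continuous (b.coord i) := (b.coord i).continuous_of_finiteDimensional
    exact hc.continuousAt.eventually (lt_mem_nhds (by simp))
  have hu := hcomb u
  have hu1 := hsum u
  set α := b.coord 0 u
  set β := b.coord 1 u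
  set γ := b.coord 2 u
  have one : ∀ i j k : Fin 3, ∀ p q r : ℝ, (∀ f : StrongDual ℝ E, f (b i) = f (b j) →
      f (b i) = f (b k) → f = 0) → p + q + r = 1 → u = p • b i + q • b j + r • b k →
      (∀ x, x = b.coord i x • b i + b.coord j x • b j + b.coord k x • b k) →
      (∀ x, b.coord i x + b.coord j x + b.coord k x = 1) →
      r < 0 → ∃ i, ∀ᶠ x in nhds (b i), x ∈ K → ¬ Disjoint (segment ℝ x u) H := by
    intro i j k p q r hsp h1 he hx1 hx2 hr
    refine ⟨k, (hev k).mono fun x hx hxK => ?_⟩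
    obtain ⟨y, hy, hyH⟩ := exists_mem_segment_of_supporting hH hK (hb i) (hb j) (hb k) (hs i)
      (hs j) hsp huK hxK he (hx1 x) h1 (hx2 x) hr hx
    exact Set.not_disjoint_iff.2 ⟨y, hy, hyH⟩
  -- `u` is outside the triangle, so it has a negative barycentric coordinate; the vertex of that
  -- coordinate is the required one, since the coordinate is positive near it.
  have hnn : ¬ (0 ≤ α ∧ 0 ≤ β ∧ 0 ≤ γ) := by
    rintro ⟨h0, h1, h2⟩
    apply huH
    have := hH.sum_mem (t := Finset.univ) (w := fun i => b.coord i u) (z := b)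
      (by intro i _; fin_cases i <;> assumption) (b.sum_coord_apply_eq_one u) fun i _ => (hb i).1
    rwa [b.linear_combination_coord_eq_self] at this
  have hspan1 : ∀ f : StrongDual ℝ E, f (b 1) = f (b 2) → f (b 1) = f (b 0) → f = 0 :=
    fun f h1 h2 => hspan f h2.symm (h2.symm.trans h1)
  have hspan2 : ∀ f : StrongDual ℝ E, f (b 2) = f (b 0) → f (b 2) = f (b 1) → f = 0 :=
    fun f h1 h2 => hspan f (h1.symm.trans h2) h1.symm
  have hu120 : u = β • b 1 + γ • b 2 + α • b 0 := by rw [hu]; module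
  have hu201 : u = γ • b 2 + α • b 0 + β • b 1 := by rw [hu]; module
  rcases lt_or_ge α 0 with h0 | h0
  · exact one 1 2 0 β γ α hspan1 (by linarith) hu120
      (fun x => by conv_lhs => rw [hcomb x]
                   module) (fun x => by linarith [hsum x]) h0
  rcases lt_or_ge β 0 with h1 | h1
  · exact one 2 0 1 γ α β hspan2 (by linarith) hu201
      (fun x => by conv_lhs => rw [hcomb x]
                   module) (fun x => by linarith [hsum x]) h1
  rcases lt_or_ge γ 0 with h2 | h2
  · exact one 0 1 2 α β γ hspan hu1 hu hcomb hsum h2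
  · exact (hnn ⟨h0, h1, h2⟩).elim

theorem not_collinear_of_mem_extremePoints {H : Set E} {v₁ v₂ v₃ : E}
    (h₁ : v₁ ∈ H.extremePoints ℝ) (h₂ : v₂ ∈ H.extremePoints ℝ) (h₃ : v₃ ∈ H.extremePoints ℝ)
    (h₁₂ : v₁ ≠ v₂) (h₁₃ : v₁ ≠ v₃) (h₂₃ : v₂ ≠ v₃) : ¬ Collinear ℝ {v₁, v₂, v₃} := by
  have key : ∀ {x y z : E}, x ∈ H → z ∈ H → y ∈ H.extremePoints ℝ → y ≠ x → y ≠ z →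
      ¬ Wbtw ℝ x y z := by
    intro x y z hx hz hy hyx hyz hw
    rw [← mem_segment_iff_wbtw] at hw
    rcases (mem_extremePoints_iff_forall_segment.1 hy).2 x hx z hz hw with h | h
    · exact hyx h.symm
    · exact hyz h.symm
  intro hc
  rcases hc.wbtw_or_wbtw_or_wbtw with h | h | h
  · exact key h₁.1 h₃.1 h₂ h₁₂.symm h₂₃ h
  · exact key h₂.1 h₁.1 h₃ h₂₃.symm h₁₃.symm h
  · exact key h₃.1 h₂.1 h₁ h₁₃ h₁₂ h

theorem Set.encard_le_two_of_forall {α : Type*} {s : Set α}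
    (h : ∀ x ∈ s, ∀ y ∈ s, ∀ z ∈ s, x ≠ y → x ≠ z → y ≠ z → False) : s.encard ≤ 2 := by
  by_contra hlt
  obtain ⟨t, hts, ht⟩ := Set.exists_subset_encard_eq (s := s) (k := 3)
    (by exact Order.add_one_le_of_lt (not_le.1 hlt))
  obtain ⟨x, y, z, hxy, hxz, hyz, rfl⟩ := Set.encard_eq_three.1 ht
  exact h x (hts (by simp)) y (hts (by simp)) z (hts (by simp)) hxy hxz hyz

/-- In the plane, the number of extreme points of `H` on the boundary of `K` to which `K \ H`
accumulates is at most twice the number of extreme points of the convex hull of `H ∪ K`. -/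
theorem encard_extremePoints_frontier_le [FiniteDimensional ℝ E] (hE : Module.finrank ℝ E = 2)
    {H K : Set E} (hH : IsCompact H) (hHc : Convex ℝ H) (hK : IsCompact K) (hKc : Convex ℝ K) :
    {v ∈ H.extremePoints ℝ | v ∈ K ∧ v ∉ interior K ∧ v ∈ closure (K \ H)}.encard ≤
      2 * ((convexHull ℝ (H ∪ K)).extremePoints ℝ).encard := by
  set U := (convexHull ℝ (H ∪ K)).extremePoints ℝ
  rcases U.finite_or_infinite with hU | hU
  swap
  · rw [hU.encard_eq, ENat.mul_top (by simp)]; exact le_top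
  set F : E → Set E := fun u => {v | v ∈ H.extremePoints ℝ ∧ v ∈ K ∧ v ∉ interior K ∧
    ∃ᶠ x in nhds v, x ∈ K ∧ u ∈ K ∧ Disjoint (segment ℝ x u) H} with hF
  have hsub : {v ∈ H.extremePoints ℝ | v ∈ K ∧ v ∉ interior K ∧ v ∈ closure (K \ H)} ⊆
      ⋃ u ∈ hU.toFinset, F u := by
    rintro v ⟨hv, hvK, hvi, hvc⟩
    have hfr := mem_closure_iff_frequently.1 hvc
    have hfr' : ∃ᶠ x in nhds v, ∃ u ∈ U, x ∈ K ∧ u ∈ K ∧ Disjoint (segment ℝ x u) H :=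
      hfr.mono fun x hx => by
        obtain ⟨u, hu, huK, hd⟩ := exists_extremePoint_segment_disjoint hH hHc hK hKc hx.1 hx.2
        exact ⟨u, hu, hx.1, huK, hd⟩
    -- Pigeonhole over the finite set `U`: one `u` must serve points arbitrarily close to `v`.
    by_contra hno
    apply hfr'
    have : ∀ u ∈ U, ∀ᶠ x in nhds v, ¬ (x ∈ K ∧ u ∈ K ∧ Disjoint (segment ℝ x u) H) := by
      intro u hu
      rw [← Filter.not_frequently]
      intro hf
      exact hno (Set.mem_biUnion (by simpa using hu) ⟨hv, hvK, hvi, hf⟩)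
    filter_upwards [(Filter.eventually_all_finite hU).2 this] with x hx
    rintro ⟨u, hu, h⟩
    exact hx u hu h
  have hcard : ∀ u, (F u).encard ≤ 2 := by
    intro u
    -- Three such points would form an affine basis, and `H` would hide `u` from all points of `K`
    -- near one of them.
    refine Set.encard_le_two_of_forall fun x hx y hy z hz hxy hxz hyz => ?_
    have hnc := not_collinear_of_mem_extremePoints hx.1 hy.1 hz.1 hxy hxz hyz
    have hind := affineIndependent_iff_not_collinear_set.2 hnc
    let b : AffineBasis (Fin 3) ℝ E :=
      ⟨![x, y, z], hind, hind.affineSpan_eq_top_iff_card_eq_finrank_add_one.2 (by simp [hE])⟩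
    have hbi : ∀ i, b i ∈ F u := fun i => by fin_cases i <;> [exact hx; exact hy; exact hz]
    have huK : u ∈ K := by
      obtain ⟨x, -, hu, -⟩ := hx.2.2.2.exists
      exact hu
    have huH : u ∉ H := by
      obtain ⟨x, -, -, hd⟩ := hx.2.2.2.exists
      exact Set.disjoint_left.1 hd (right_mem_segment ℝ x u)
    obtain ⟨i, hi⟩ := exists_eventually_not_disjoint_segment hHc hKc b
      (fun i => ⟨(hbi i).1.1, (hbi i).2.1⟩)
      (fun i => hKc.exists_supporting_functional (hbi i).2.1 (hbi i).2.2.1) huK huH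
    exact (hbi i).2.2.2 (hi.mono fun x hx h => hx h.1 h.2.2)
  calc _ ≤ (⋃ u ∈ hU.toFinset, F u).encard := Set.encard_le_encard hsub
    _ ≤ ∑ u ∈ hU.toFinset, (F u).encard := Finset.set_encard_biUnion_le _ _
    _ ≤ ∑ u ∈ hU.toFinset, 2 := Finset.sum_le_sum fun u _ => hcard u
    _ = 2 * U.encard := by
      rw [Finset.sum_const, nsmul_eq_mul, mul_comm, hU.encard_eq_coe_toFinset_card]

end Plane

/-! ### Inclusion-minimal realizations: local structure and existence -/

section MinimalRealizations

variable {n d : ℕ} {X Y Z : Fin n → Set (EuclideanSpace ℝ (Fin d))}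
  {P : Set (EuclideanSpace ℝ (Fin d))}

/-- Points of `P` keep their patterns and realize every codeword, so no codeword can be lost. -/
theorem IsShrinking.of_code_subset (hP : IsSetOfRepresentatives X P)
    (hZ : IsCompactConvexTuple Z) (hsub : ∀ i, Z i ⊆ X i) (hinter : ∀ i, Z i ∩ P = X i ∩ P)
    (hcode : code Z ⊆ code X) : IsShrinking X P Z := by
  refine ⟨hZ, hsub, hinter, hcode.antisymm fun c hc => ?_⟩
  rw [hP] at hc
  obtain ⟨p, hp, rfl⟩ := hc
  refine ⟨p, Set.ext fun i => ?_⟩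
  have := Set.ext_iff.1 (hinter i) p
  simpa [hp, intersectionPattern] using this

theorem IsCompactConvexTuple.isCompact_convexHull (hY : IsCompactConvexTuple Y)
    (S : Finset (Fin n)) : IsCompact (convexHull ℝ (⋃ k ∈ S, Y k)) :=
  isCompact_convexHull_biUnion S Y fun i _ => hY i

/-- At an extreme point of the convex hull of some sets of an inclusion-minimal realization,
outside `P`, the boundary of another set of the realization leaves the hull. -/
theorem IsInclusionMinimal.exists_mem_closure_diff [NeZero d] (hPf : P.Finite)
    (hP : IsSetOfRepresentatives X P) (hY : IsInclusionMinimal X P Y) {S : Finset (Fin n)}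
    {v : EuclideanSpace ℝ (Fin d)}
    (hv : v ∈ (convexHull ℝ (⋃ k ∈ S, Y k)).extremePoints ℝ) (hvP : v ∉ P) :
    ∃ k, v ∈ Y k ∧ v ∉ interior (Y k) ∧ v ∈ closure (Y k \ convexHull ℝ (⋃ k ∈ S, Y k)) := by
  by_contra! hno
  have hYc := hY.1.compactConvex
  have hHcomp := hYc.isCompact_convexHull S
  set H := convexHull ℝ (⋃ k ∈ S, Y k) with hH
  have hvint : v ∉ interior H := fun h =>
    Set.disjoint_left.1 (disjoint_interior_extremePoints H) h hv
  have hev : ∀ᶠ x in nhds v, x ∉ P ∧ ∀ k, (v ∉ Y k → x ∉ Y k) ∧ (v ∈ interior (Y k) → x ∈ Y k) ∧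
      (v ∈ Y k → v ∉ interior (Y k) → x ∈ Y k → x ∈ H) := by
    refine (hPf.isClosed.isOpen_compl.eventually_mem hvP).and (Filter.eventually_all.2 fun k => ?_)
    refine Filter.Eventually.and ?_ (Filter.Eventually.and ?_ ?_)
    · by_cases h : v ∈ Y k
      · simp [h]
      · filter_upwards [(hYc k).1.isClosed.isOpen_compl.eventually_mem h] with x hx _ using hx
    · by_cases h : v ∈ interior (Y k)
      · filter_upwards [isOpen_interior.eventually_mem h] with x hx _ using interior_subset hx
      · simp [h]
    · by_cases h : v ∈ Y k ∧ v ∉ interior (Y k)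
      · have := hno k h.1 h.2
        rw [mem_closure_iff_frequently, Filter.not_frequently] at this
        filter_upwards [this] with x hx _ _ hxk
        by_contra hxH
        exact hx ⟨hxk, hxH⟩
      · exact Filter.Eventually.of_forall fun x h1 h2 => (h ⟨h1, h2⟩).elim
  obtain ⟨ε, hε, hball⟩ := Metric.nhds_basis_closedBall.eventually_iff.1 hev
  obtain ⟨f, r, hr, hcapH⟩ := exists_cap_of_mem_extremePoints hHcomp (convex_convexHull ℝ _) hv hε
  -- The cap is small in `H`, and also in `Y k`: a far point of `Y k` above level `r` would yield,
  -- by convexity, one at distance exactly `ε` from `v`, which lies in `H`.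
  have hcap : ∀ k, v ∈ Y k → v ∉ interior (Y k) → ∀ y ∈ Y k, r < f y → dist y v < ε := by
    intro k hvk hvi y hy hry
    by_contra! hd
    have hd0 : 0 < dist y v := hε.trans_le hd
    set t := ε / dist y v with ht
    have ht0 : 0 < t := div_pos hε hd0
    have ht1 : t ≤ 1 := (div_le_one hd0).2 hd
    have hzk : AffineMap.lineMap v y t ∈ Y k := (hYc k).2.lineMap_mem hvk hy ⟨ht0.le, ht1⟩
    have hzd : dist (AffineMap.lineMap v y t) v = ε := by
      rw [dist_lineMap_left, Real.norm_of_nonneg ht0.le, dist_comm v y, ht,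
        div_mul_cancel₀ _ hd0.ne']
    have hzH := ((hball (Metric.mem_closedBall.2 hzd.le)).2 k).2.2 hvk hvi hzk
    refine (hcapH _ hzH ?_).ne hzd
    rw [AffineMap.lineMap_apply_module, map_add, map_smul, map_smul, smul_eq_mul, smul_eq_mul]
    nlinarith [mul_pos ht0 (sub_pos.2 hry), mul_nonneg (sub_nonneg.2 ht1) (sub_pos.2 hr).le]
  set Z : Fin n → Set (EuclideanSpace ℝ (Fin d)) :=
    fun k => Y k ∩ {y | v ∈ Y k ∧ v ∉ interior (Y k) → f y ≤ r} with hZ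
  have hZY : ∀ k, Z k ⊆ Y k := fun k => Set.inter_subset_left
  have hpat : ∀ q, (∀ k, v ∈ Y k → v ∉ interior (Y k) → q ∈ Y k → f q ≤ r) →
      intersectionPattern Z q = intersectionPattern Y q := fun q hq =>
    Set.ext fun k => ⟨fun h => h.1, fun h => ⟨h, fun h' => hq k h'.1 h'.2 h⟩⟩
  have hshrink : IsShrinking X P Z := by
    refine IsShrinking.of_code_subset hP (fun k => ?_) (fun k => (hZY k).trans (hY.1.subset k))
      (fun k => ?_) ?_
    · by_cases h : v ∈ Y k ∧ v ∉ interior (Y k)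
      · simp only [hZ, h, not_false_eq_true, and_self, forall_const]
        exact ⟨(hYc k).1.inter_right (isClosed_le f.continuous continuous_const),
          (hYc k).2.inter (convex_halfSpace_le f.toLinearMap.isLinear r)⟩
      · simpa only [hZ, h, false_imp_iff, Set.ofPred_true, Set.inter_univ] using hYc k
    · rw [← hY.1.inter_eq k]
      refine (Set.inter_subset_inter_left _ (hZY k)).antisymm fun y hy => ⟨⟨hy.1, fun h => ?_⟩, hy.2⟩
      by_contra! hry
      exact (hball (Metric.mem_closedBall.2 (hcap k h.1 h.2 y hy.1 hry).le)).1 hy.2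
    · rw [← hY.1.code_eq]
      rintro _ ⟨q, rfl⟩
      by_cases hq : ∀ k, v ∈ Y k → v ∉ interior (Y k) → q ∈ Y k → f q ≤ r
      · exact ⟨q, (hpat q hq).symm⟩
      push Not at hq
      obtain ⟨k₀, hk₀, hk₀', hqk₀, hqr⟩ := hq
      have hqb := (hball (Metric.mem_closedBall.2 (hcap k₀ hk₀ hk₀' q hqk₀ hqr).le)).2
      -- The new pattern of `q` is the set of `k` with `v ∈ interior (Y k)`. It already occurs in
      -- `Y`, at any point near `v` outside `H`.
      obtain ⟨x, hxb, hxH⟩ : ∃ x ∈ Metric.closedBall v ε, x ∉ H := by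
        by_contra! hsub
        exact hvint (mem_interior_iff_mem_nhds.2
          (Filter.mem_of_superset (Metric.closedBall_mem_nhds v hε) hsub))
      have hxb' := (hball hxb).2
      refine ⟨x, Set.ext fun k => ?_⟩
      change x ∈ Y k ↔ q ∈ Y k ∧ (v ∈ Y k ∧ v ∉ interior (Y k) → f q ≤ r)
      by_cases hvi : v ∈ interior (Y k)
      · simp [(hxb' k).2.1 hvi, (hqb k).2.1 hvi, hvi]
      by_cases hvk : v ∈ Y k
      · have : x ∉ Y k := fun h => hxH ((hxb' k).2.2 hvk hvi h)
        simp [this, hvk, hvi, hqr]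
      · simp [(hxb' k).1 hvk, (hqb k).1 hvk]
  have hEq := hY.2 Z hshrink hZY
  -- The cut is proper: `v` lies in some `Y k` with `k ∈ S`, on its boundary because `Y k ⊆ H`, and
  -- is removed from it.
  have hvU := extremePoints_convexHull_subset hv
  simp only [Set.mem_iUnion] at hvU
  obtain ⟨k, hkS, hvk⟩ := hvU
  have hvi : v ∉ interior (Y k) := fun h =>
    hvint (interior_mono ((Set.subset_biUnion_of_mem (u := Y) hkS).trans
      (subset_convexHull ℝ _)) h)
  have hvZ : v ∈ Z k := by rw [hEq]; exact hvk
  exact (hvZ.2 ⟨hvk, hvi⟩).not_gt hr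

/-- Every tuple of compact convex sets has an inclusion-minimal shrinking. -/
theorem exists_isInclusionMinimal (hX : IsCompactConvexTuple X)
    (hP : IsSetOfRepresentatives X P) : ∃ Y, IsInclusionMinimal X P Y := by
  have hXX : IsShrinking X P X := ⟨hX, fun _ => subset_rfl, fun _ => rfl, rfl⟩
  suffices h : ∀ c ⊆ {Z : (Fin n → Set (EuclideanSpace ℝ (Fin d)))ᵒᵈ |
      IsShrinking X P (OrderDual.ofDual Z)}, IsChain (· ≤ ·) c → ∀ Z₀ ∈ c,
      ∃ W ∈ {Z : (Fin n → Set (EuclideanSpace ℝ (Fin d)))ᵒᵈ |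
        IsShrinking X P (OrderDual.ofDual Z)}, ∀ Z ∈ c, Z ≤ W by
    obtain ⟨Y, -, hY⟩ := zorn_le_nonempty₀ _ h (OrderDual.toDual X) hXX
    exact ⟨OrderDual.ofDual Y, hY.1, fun Z hZ hle =>
      (hY.eq_of_le (y := OrderDual.toDual Z) hZ hle).symm⟩
  intro c hc hchain Z₀ hZ₀
  let W : Fin n → Set (EuclideanSpace ℝ (Fin d)) := fun i => ⋂ Z ∈ c, OrderDual.ofDual Z i
  have hWle : ∀ Z ∈ c, ∀ i, W i ⊆ OrderDual.ofDual Z i := fun Z hZ i => Set.biInter_subset_of_mem hZ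
  refine ⟨OrderDual.toDual W, ?_, fun Z hZ i => hWle Z hZ i⟩
  refine IsShrinking.of_code_subset hP (fun i => ⟨?_, ?_⟩)
    (fun i => (hWle Z₀ hZ₀ i).trans ((hc hZ₀).subset i)) (fun i => ?_) ?_
  · exact ((hc hZ₀).compactConvex i).1.of_isClosed_subset
      (isClosed_biInter fun Z hZ => ((hc hZ).compactConvex i).1.isClosed) (hWle Z₀ hZ₀ i)
  · exact convex_iInter₂ fun Z hZ => ((hc hZ).compactConvex i).2
  · ext p
    constructor
    · exact fun h => ⟨(hc hZ₀).subset i (hWle Z₀ hZ₀ i h.1), h.2⟩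
    · intro h
      refine ⟨Set.mem_iInter₂.2 fun Z hZ => ?_, h.2⟩
      rw [← (hc hZ).inter_eq i] at h
      exact h.1
  · rintro _ ⟨q, rfl⟩
    -- Only finitely many patterns of `q` occur along the chain; the minimal one is its pattern in
    -- the intersection.
    obtain ⟨_, ⟨⟨Z, hZ, rfl⟩, hmin⟩⟩ :=
      (Set.toFinite ((fun Z => intersectionPattern (OrderDual.ofDual Z) q) '' c)).exists_minimal
        ⟨_, Set.mem_image_of_mem _ hZ₀⟩
    rw [← (hc hZ).code_eq]
    refine ⟨q, Set.Subset.antisymm (fun i hi => Set.mem_iInter₂.2 fun Z' hZ' => ?_)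
      fun i hi => hWle Z hZ i hi⟩
    rcases hchain.total hZ hZ' with hle | hle
    · exact hmin (Set.mem_image_of_mem _ hZ') (fun j hj => hle j hj) hi
    · exact hle i hi

theorem exists_isSetOfRepresentatives (X : Fin n → Set (EuclideanSpace ℝ (Fin d))) :
    ∃ P : Finset (EuclideanSpace ℝ (Fin d)),
      IsSetOfRepresentatives X (P : Set (EuclideanSpace ℝ (Fin d))) ∧ P.card ≤ 2 ^ n := by
  classical
  choose p hp using fun c : code X => c.2
  have : Fintype (code X) := Fintype.ofFinite _
  refine ⟨Finset.univ.image p, ?_, ?_⟩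
  · ext c
    constructor
    · exact fun hc => ⟨p ⟨c, hc⟩, by simp, hp ⟨c, hc⟩⟩
    · rintro ⟨q, -, rfl⟩
      exact ⟨q, rfl⟩
  · refine Finset.card_image_le.trans ?_
    rw [Finset.card_univ]
    refine (Fintype.card_subtype_le _).trans ?_
    simp

end MinimalRealizations

/-! ### The vertex recursion and the bounds -/

section PlanarBound

variable {n : ℕ} {X Y : Fin n → Set (EuclideanSpace ℝ (Fin 2))}
  {P : Finset (EuclideanSpace ℝ (Fin 2))}

theorem IsInclusionMinimal.encard_extremePoints_le_add_sum
    (hP : IsSetOfRepresentatives X (P : Set (EuclideanSpace ℝ (Fin 2))))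
    (hY : IsInclusionMinimal X (P : Set (EuclideanSpace ℝ (Fin 2))) Y) (S : Finset (Fin n)) :
    ((convexHull ℝ (⋃ k ∈ S, Y k)).extremePoints ℝ).encard ≤
      P.card + ∑ k ∈ Sᶜ, 2 * ((convexHull ℝ (⋃ j ∈ insert k S, Y j)).extremePoints ℝ).encard := by
  have hYc := hY.1.compactConvex
  have hHcomp := hYc.isCompact_convexHull S
  set H := convexHull ℝ (⋃ k ∈ S, Y k) with hH
  set W : Fin n → Set (EuclideanSpace ℝ (Fin 2)) := fun k =>
    {v ∈ H.extremePoints ℝ | v ∈ Y k ∧ v ∉ interior (Y k) ∧ v ∈ closure (Y k \ H)} with hW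
  have hsub : H.extremePoints ℝ ⊆ ↑P ∪ ⋃ k ∈ Sᶜ, W k := by
    intro v hv
    by_cases hvP : v ∈ P
    · exact Or.inl hvP
    obtain ⟨k, hk⟩ := hY.exists_mem_closure_diff P.finite_toSet hP hv hvP
    refine Or.inr (Set.mem_biUnion (x := k) ?_ ⟨hv, hk⟩)
    simp only [Finset.coe_compl, Set.mem_compl_iff, Finset.mem_coe]
    intro hkS
    have hYH : Y k ⊆ H := (Set.subset_biUnion_of_mem (u := Y) hkS).trans (subset_convexHull ℝ _)
    rw [Set.sdiff_eq_empty.2 hYH, closure_empty] at hk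
    exact hk.2.2
  refine (Set.encard_le_encard hsub).trans ((Set.encard_union_le _ _).trans ?_)
  rw [Set.encard_coe_eq_coe_finsetCard]
  refine add_le_add le_rfl ((Finset.set_encard_biUnion_le _ _).trans
    (Finset.sum_le_sum fun k _ => ?_))
  have hins : convexHull ℝ (⋃ j ∈ insert k S, Y j) = convexHull ℝ (H ∪ Y k) := by
    rw [Finset.set_biUnion_insert, Set.union_comm]
    exact ((convexHull ℝ).closure_sup_closure_left _ _).symm
  rw [hins]
  exact encard_extremePoints_frontier_le (by simp) hHcomp (convex_convexHull ℝ _) (hYc k).1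
    (hYc k).2

theorem IsInclusionMinimal.encard_extremePoints_le
    (hP : IsSetOfRepresentatives X (P : Set (EuclideanSpace ℝ (Fin 2))))
    (hY : IsInclusionMinimal X (P : Set (EuclideanSpace ℝ (Fin 2))) Y) (m : ℕ) :
    ∀ S : Finset (Fin n), Sᶜ.card = m →
      ((convexHull ℝ (⋃ k ∈ S, Y k)).extremePoints ℝ).encard ≤
        ((3 ^ (m + 1) * m ! * P.card : ℕ) : ℕ∞) := by
  induction m with
  | zero =>
    intro S hS
    refine (hY.encard_extremePoints_le_add_sum hP S).trans ?_
    rw [Finset.card_eq_zero.1 hS, Finset.sum_empty, add_zero]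
    exact_mod_cast (by simp; omega)
  | succ m ih =>
    intro S hS
    refine (hY.encard_extremePoints_le_add_sum hP S).trans ?_
    have h : ∀ k ∈ Sᶜ, 2 * ((convexHull ℝ (⋃ j ∈ insert k S, Y j)).extremePoints ℝ).encard ≤
        ((2 * (3 ^ (m + 1) * m ! * P.card) : ℕ) : ℕ∞) := by
      intro k hk
      rw [Nat.cast_mul]
      refine mul_le_mul_right (ih _ ?_) _
      rw [Finset.compl_insert, Finset.card_erase_of_mem hk, hS, Nat.add_sub_cancel]
    refine (add_le_add le_rfl (Finset.sum_le_sum h)).trans ?_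
    rw [Finset.sum_const, hS, nsmul_eq_mul]
    norm_cast
    -- The base 3 is 1 + 2: the recursion contributes the 2, and the term |P| is absorbed into one
    -- further copy.
    have h1 : 1 ≤ 3 ^ (m + 1) * (m + 1)! :=
      Nat.mul_pos (pow_pos (by norm_num) _) (Nat.factorial_pos _)
    calc P.card + (m + 1) * (2 * (3 ^ (m + 1) * m ! * P.card))
        = 1 * P.card + 2 * (3 ^ (m + 1) * (m + 1)!) * P.card := by
          rw [Nat.factorial_succ]; ring
      _ ≤ 3 ^ (m + 1) * (m + 1)! * P.card + 2 * (3 ^ (m + 1) * (m + 1)!) * P.card :=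
          Nat.add_le_add_right (Nat.mul_le_mul_right _ h1) _
      _ = 3 ^ (m + 1 + 1) * (m + 1)! * P.card := by ring

theorem IsInclusionMinimal.numVertices_le
    (hP : IsSetOfRepresentatives X (P : Set (EuclideanSpace ℝ (Fin 2))))
    (hY : IsInclusionMinimal X (P : Set (EuclideanSpace ℝ (Fin 2))) Y) (i : Fin n) :
    numVertices (Y i) ≤ ((3 ^ n * (n - 1)! * P.card : ℕ) : ℕ∞) := by
  have h := hY.encard_extremePoints_le hP (n - 1) {i} (by simp [Finset.card_compl])
  -- The index `i` witnesses n ≥ 1, so the exponent (n - 1) + 1 is n.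
  rw [Nat.sub_add_cancel i.pos] at h
  simpa [numVertices, ((hY.1.compactConvex i).2).convexHull_eq] using h

theorem isPolygon_of_numVertices_ne_top {K : Set (EuclideanSpace ℝ (Fin 2))} (hK : IsCompact K)
    (hKc : Convex ℝ K) (h : numVertices K ≠ ⊤) : IsPolygon K := by
  have hfin : (K.extremePoints ℝ).Finite := Set.encard_ne_top_iff.1 h
  refine ⟨hfin.toFinset, ?_⟩
  rw [hfin.coe_toFinset, ← (hfin.isClosed_convexHull ℝ).closure_eq,
    closure_convexHull_extremePoints hK hKc]

theorem IsInclusionMinimal.isPolygon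
    (hP : IsSetOfRepresentatives X (P : Set (EuclideanSpace ℝ (Fin 2))))
    (hY : IsInclusionMinimal X (P : Set (EuclideanSpace ℝ (Fin 2))) Y) (i : Fin n) :
    IsPolygon (Y i) :=
  isPolygon_of_numVertices_ne_top (hY.1.compactConvex i).1 (hY.1.compactConvex i).2
    (ne_top_of_le_ne_top (ENat.natCast_ne_top _) (hY.numVertices_le hP i))

theorem IsInclusionMinimal.numVertices_le_of_card_le
    (hP : IsSetOfRepresentatives X (P : Set (EuclideanSpace ℝ (Fin 2)))) (hcard : P.card ≤ 2 ^ n)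
    (hY : IsInclusionMinimal X (P : Set (EuclideanSpace ℝ (Fin 2))) Y) (i : Fin n) :
    numVertices (Y i) ≤ ((6 ^ n * (n - 1)! : ℕ) : ℕ∞) := by
  refine (hY.numVertices_le hP i).trans (Nat.cast_le.2 ?_)
  calc 3 ^ n * (n - 1)! * P.card ≤ 3 ^ n * (n - 1)! * 2 ^ n := Nat.mul_le_mul_left _ hcard
    _ = 6 ^ n * (n - 1)! := by rw [show 6 = 3 * 2 by rfl, mul_pow]; ring

end PlanarBound

theorem mainTheorem3 (n : ℕ) :
    -- the bound in terms of `P`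
    (∀ (X Y : Fin n → Set (EuclideanSpace ℝ (Fin 2))) (P : Finset (EuclideanSpace ℝ (Fin 2))),
      IsCompactConvexTuple X → IsSetOfRepresentatives X (P : Set (EuclideanSpace ℝ (Fin 2))) →
      IsInclusionMinimal X (P : Set (EuclideanSpace ℝ (Fin 2))) Y →
      ∀ i, IsPolygon (Y i) ∧ numVertices (Y i) ≤ ((3 ^ n * (n - 1)! * P.card : ℕ) : ℕ∞)) ∧
    -- the bound when `P` has at most `2 ^ n` points
    (∀ (X Y : Fin n → Set (EuclideanSpace ℝ (Fin 2))) (P : Finset (EuclideanSpace ℝ (Fin 2))),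
      IsCompactConvexTuple X → IsSetOfRepresentatives X (P : Set (EuclideanSpace ℝ (Fin 2))) →
      P.card ≤ 2 ^ n →
      IsInclusionMinimal X (P : Set (EuclideanSpace ℝ (Fin 2))) Y →
      ∀ i, IsPolygon (Y i) ∧ numVertices (Y i) ≤ ((6 ^ n * (n - 1)! : ℕ) : ℕ∞)) ∧
    -- such a `P` and such a `Y` always exist, hence a realization by polygons
    (∀ (C : Set (Set (Fin n))) (X : Fin n → Set (EuclideanSpace ℝ (Fin 2))),
      IsClosedRealization C X →
      ∃ (P : Finset (EuclideanSpace ℝ (Fin 2))) (Y : Fin n → Set (EuclideanSpace ℝ (Fin 2))),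
        IsSetOfRepresentatives X (P : Set (EuclideanSpace ℝ (Fin 2))) ∧ P.card ≤ 2 ^ n ∧
        IsInclusionMinimal X (P : Set (EuclideanSpace ℝ (Fin 2))) Y ∧
        IsClosedRealization C Y ∧
        ∀ i, IsPolygon (Y i) ∧ numVertices (Y i) ≤ ((6 ^ n * (n - 1)! : ℕ) : ℕ∞)) := by
  refine ⟨fun X Y P _ hP hY i => ⟨hY.isPolygon hP i, hY.numVertices_le hP i⟩,
    fun X Y P _ hP hcard hY i => ⟨hY.isPolygon hP i, hY.numVertices_le_of_card_le hP hcard i⟩,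
    fun C X hX => ?_⟩
  obtain ⟨P, hP, hcard⟩ := exists_isSetOfRepresentatives X
  obtain ⟨Y, hY⟩ := exists_isInclusionMinimal hX.1 hP
  exact ⟨P, Y, hP, hcard, hY, ⟨hY.1.compactConvex, hY.1.code_eq.trans hX.2⟩,
    fun i => ⟨hY.isPolygon hP i, hY.numVertices_le_of_card_le hP hcard i⟩⟩
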